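/- All graphs are finite and simple. For a vertex $x$ of a graph $G$, the unit sphere $S(x)$ is the subgraph of $G$ induced on the neighbours of $x$, and $G-x$ is the graph $G$ with $x$ removed. A graph is \emph{contractible} if it is the one-point graph $K_1$ or if it has a vertex $x$ such that both $G-x$ and $S(x)$ are contractible. The empty graph is the only $(-1)$-sphere, and for $d\ge 0$ a graph $G$ is a \emph{$d$-sphere} if $S(x)$ is a $(d-1)$-sphere for every vertex $x$ and $G-x$ is contractible for some vertex $x$. A \emph{$k$-simplex} of $G$ is a complete subgraph with $k+1$ vertices (so the empty subgraph is the only $(-1)$-simplex, and there are no $(-2)$-simplices or $(-3)$-simplices). The \emph{degree} of a $(d-2)$-simplex $x$ of a $d$-sphere $G$ is the length (the number of vertices) of the circular graph $\hat{x}$ induced on the vertices adjacent to every vertex of $x$; for $d=1$, where $x$ is empty, $\hat{x}=G$. A $d$-sphere is \emph{Eulerian} if all its $(d-2)$-simplices have even degree. \textbf{Proposition (Kempe--Heawood generalization).} For every integer $d\ge -1$, every Eulerian $d$-sphere has chromatic number exactly $d+1$. -/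

import Mathlib

namespace EulerianSphere

universe u

variable {V : Type u}

/-- Vertex set of the unit sphere `S(x)` of `x` in the subgraph of `G` induced on `A`. All subgraphs
below are induced subgraphs of one ambient graph `G` and are represented by their vertex sets. -/
def unitSphere (G : SimpleGraph V) (A : Set V) (x : V) : Set V :=
  {y | y ∈ A ∧ G.Adj x y}

/-- The subgraph of `G` induced on `A` is contractible: it is the one-point graph, or for some
vertex `x` both the graph without `x` and the unit sphere of `x` are contractible. -/
inductive IsContractibleOn (G : SimpleGraph V) : Set V → Prop
  | point (x : V) : IsContractibleOn G {x}
  | step (A : Set V) (x : V) (hx : x ∈ A) (hdel : IsContractibleOn G (A \ {x}))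
      (hsph : IsContractibleOn G (unitSphere G A x)) : IsContractibleOn G A

/-- The subgraph of `G` induced on `A` is a sphere of dimension `d`: the empty graph is the only
`(-1)`-sphere, and a `(d+1)`-sphere is a graph all of whose unit spheres are `d`-spheres and which
becomes contractible after the removal of some vertex. -/
inductive IsSphereOn (G : SimpleGraph V) : ℤ → Set V → Prop
  | empty : IsSphereOn G (-1) ∅
  | step (d : ℤ) (A : Set V) (hunit : ∀ x ∈ A, IsSphereOn G d (unitSphere G A x))
      (hpunct : ∃ x ∈ A, IsContractibleOn G (A \ {x})) : IsSphereOn G (d + 1) A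

/-- `G` is a `d`-sphere. -/
def IsSphere (G : SimpleGraph V) (d : ℤ) : Prop :=
  IsSphereOn G d Set.univ

/-- `s` is a `k`-simplex of `G`: a complete subgraph with `k + 1` vertices. The empty complete
subgraph is the only `(-1)`-simplex. -/
def IsSimplex (G : SimpleGraph V) (k : ℤ) (s : Finset V) : Prop :=
  G.IsClique (s : Set V) ∧ (s.card : ℤ) = k + 1

/-- Vertex set of the dual sphere of `s`, the intersection of the unit spheres `S(x)`, `x ∈ s`
(all vertices if `s` is empty). -/
def dualSphere (G : SimpleGraph V) (s : Finset V) : Set V :=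
  ⋂ x ∈ s, unitSphere G Set.univ x

/-- The degree of `s`: the number of vertices of its dual sphere. If `s` is a `(d-2)`-simplex of a
`d`-sphere, the dual sphere is a circular graph and this number is its length. -/
noncomputable def degree (G : SimpleGraph V) (s : Finset V) : ℕ :=
  (dualSphere G s).ncard

/-- `G` is an Eulerian `d`-sphere: a `d`-sphere all of whose `(d-2)`-simplices have even degree. -/
def IsEulerianSphere (G : SimpleGraph V) (d : ℤ) : Prop :=
  IsSphere G d ∧ ∀ s : Finset V, IsSimplex G (d - 2) s → Even (degree G s)

end EulerianSphere

/-!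
A `d`-sphere contains a clique with `d + 1` vertices (`IsSphereOn.exists_clique_superset`), so it
needs at least `d + 1` colours. That `d + 1` colours suffice is proved by induction on `d`, by a
monodromy argument.

The unit sphere of a vertex of an Eulerian `d`-sphere is an Eulerian `(d-1)`-sphere, so by
induction the ball around each vertex `v` has a proper colouring `c v` with `d + 1` colours. A
proper colouring of a `d`-sphere with `d + 1` colours is unique up to a permutation of the colours
(`IsSphereOn.color_eq_of_color_eq`), and the same is true on the intersection of two or three
balls with adjacent centres, which is the join of a simplex and a sphere. So for adjacent `v`, `w`
there is exactly one permutation `φ v w` of the colours that carries `c v` to `c w` where both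
balls meet, and on triangles these permutations satisfy the cocycle condition.

A cocycle `φ` over a contractible graph is a coboundary, `φ v w = π w * (π v)⁻¹`
(`IsContractibleOn.exists_potential`): a potential extends over one more vertex as soon as the unit
sphere of that vertex is connected (`exists_potential_insert`). The sphere minus a suitable vertex
`x` is contractible, and for `d ≥ 2` the unit sphere of `x` is connected, so that a potential `π`
exists on the whole sphere; then `v ↦ (π v)⁻¹ (c v v)` is a proper colouring. For `d = 1` the unit
sphere of `x` consists of two points, and a count of edges shows that they have the same colour
because the number of vertices is even (`exists_proper_coloring_of_circle`).

Dimensions are written as `n - 1` with `n : ℕ` the number of colours, so that inductions start at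
the empty sphere.
-/

namespace EulerianSphere

universe u

variable {V : Type u} {G : SimpleGraph V} {A : Set V}

/-! ### Spheres -/

lemma mem_unitSphere {x y : V} : y ∈ unitSphere G A x ↔ y ∈ A ∧ G.Adj x y := Iff.rfl

lemma unitSphere_subset (x : V) : unitSphere G A x ⊆ A := fun _ h => h.1

lemma IsSphereOn.neg_one_le {d : ℤ} (h : IsSphereOn G d A) : -1 ≤ d := by
  induction h with
  | empty => rfl
  | step d A _ hp ih =>
    obtain ⟨x, hx, _⟩ := hp
    have := ih x hx
    omega

lemma IsSphereOn.eq_empty (h : IsSphereOn G (((0 : ℕ) : ℤ) - 1) A) : A = ∅ := by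
  generalize hd : (((0 : ℕ) : ℤ) - 1) = d at h
  cases h with
  | empty => rfl
  | step d A hu hp =>
    obtain ⟨x, hx, _⟩ := hp
    have := (hu x hx).neg_one_le
    push_cast at hd
    omega

lemma IsSphereOn.of_succ {n : ℕ} (h : IsSphereOn G (((n + 1 : ℕ) : ℤ) - 1) A) :
    (∀ x ∈ A, IsSphereOn G ((n : ℤ) - 1) (unitSphere G A x)) ∧
      ∃ x ∈ A, IsContractibleOn G (A \ {x}) := by
  generalize hd : (((n + 1 : ℕ) : ℤ) - 1) = d at h
  cases h with
  | empty => push_cast at hd; omega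
  | step d A hu hp =>
    obtain rfl : d = (n : ℤ) - 1 := by push_cast at hd; omega
    exact ⟨hu, hp⟩

lemma IsSphereOn.nonempty {n : ℕ} (h : IsSphereOn G (((n + 1 : ℕ) : ℤ) - 1) A) : A.Nonempty :=
  let ⟨x, hx, _⟩ := h.of_succ.2
  ⟨x, hx⟩

/-- Every simplex of a `d`-sphere lies in a `d`-simplex. -/
lemma IsSphereOn.exists_clique_superset {n : ℕ} (h : IsSphereOn G ((n : ℤ) - 1) A) {s : Finset V}
    (hsA : (s : Set V) ⊆ A) (hs : G.IsClique (s : Set V)) :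
    ∃ t : Finset V, s ⊆ t ∧ (t : Set V) ⊆ A ∧ G.IsClique (t : Set V) ∧ t.card = n := by
  classical
  induction n generalizing A s with
  | zero =>
    obtain rfl : s = ∅ := by
      rw [h.eq_empty] at hsA
      simpa using hsA
    exact ⟨∅, by simp, by simp, by simp, rfl⟩
  | succ n ih =>
    obtain ⟨x, hxA, hx⟩ : ∃ x ∈ A, ((s.erase x : Finset V) : Set V) ⊆ unitSphere G A x := by
      rcases s.eq_empty_or_nonempty with rfl | ⟨x, hx⟩
      · obtain ⟨x, hx⟩ := h.nonempty
        exact ⟨x, hx, by simp⟩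
      · refine ⟨x, hsA hx, fun y hy => ?_⟩
        have hy' := Finset.mem_erase.1 (Finset.mem_coe.1 hy)
        exact ⟨hsA hy'.2, hs hx hy'.2 hy'.1.symm⟩
    obtain ⟨t, hst, htA, ht, hcard⟩ := ih (h.of_succ.1 x hxA) hx
      (hs.subset (by simp))
    have hxt : x ∉ t := fun hxt => (htA hxt).2.ne rfl
    refine ⟨insert x t, fun y hy => ?_, ?_, ?_, by rw [Finset.card_insert_of_notMem hxt, hcard]⟩
    · by_cases hyx : y = x
      · simp [hyx]
      · exact Finset.mem_insert_of_mem (hst (Finset.mem_erase.2 ⟨hyx, hy⟩))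
    · rw [Finset.coe_insert]
      exact Set.insert_subset hxA (htA.trans (unitSphere_subset x))
    · rw [Finset.coe_insert, SimpleGraph.isClique_insert]
      exact ⟨ht, fun y hy _ => (htA hy).2⟩

/-! ### Connectedness -/

lemma IsContractibleOn.nonempty (h : IsContractibleOn G A) : A.Nonempty := by
  cases h with
  | point x => exact ⟨x, rfl⟩
  | step A x hx _ _ => exact ⟨x, hx⟩

/-- If a graph is connected after the removal of a vertex that has a neighbour, it is connected.
Connectedness is expressed by the propagation of predicates along edges. -/
lemma forall_of_adj_of_diff_singleton {x z : V} (hx : x ∈ A) (hz : z ∈ unitSphere G A x)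
    (hconn : ∀ P : V → Prop, (∀ a ∈ A \ {x}, ∀ b ∈ A \ {x}, G.Adj a b → P a → P b) →
      ∀ a ∈ A \ {x}, ∀ b ∈ A \ {x}, P a → P b)
    {P : V → Prop} (hP : ∀ a ∈ A, ∀ b ∈ A, G.Adj a b → P a → P b) :
    ∀ a ∈ A, ∀ b ∈ A, P a → P b := by
  have hzx : z ∈ A \ {x} := ⟨hz.1, hz.2.ne'⟩
  have hrest := hconn P fun a ha b hb => hP a ha.1 b hb.1
  have to_z : ∀ a ∈ A, P a → P z := fun a ha hPa => by
    by_cases hax : a = x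
    · subst hax
      exact hP _ ha _ hz.1 hz.2 hPa
    · exact hrest a ⟨ha, hax⟩ z hzx hPa
  have of_z : ∀ b ∈ A, P z → P b := fun b hb hPz => by
    by_cases hbx : b = x
    · subst hbx
      exact hP _ hz.1 _ hb hz.2.symm hPz
    · exact hrest z hzx b ⟨hb, hbx⟩ hPz
  exact fun a ha b hb hPa => of_z b hb (to_z a ha hPa)

/-- Contractible graphs are connected. -/
lemma IsContractibleOn.forall_of_adj (h : IsContractibleOn G A) {P : V → Prop}
    (hP : ∀ a ∈ A, ∀ b ∈ A, G.Adj a b → P a → P b) : ∀ a ∈ A, ∀ b ∈ A, P a → P b := by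
  induction h generalizing P with
  | point x =>
    rintro a rfl b rfl hPa
    exact hPa
  | step A x hx _ hsph ih _ =>
    obtain ⟨z, hz⟩ := hsph.nonempty
    exact forall_of_adj_of_diff_singleton hx hz (fun _ => ih) hP

/-- Spheres of positive dimension are connected. -/
lemma IsSphereOn.forall_of_adj {n : ℕ} (h : IsSphereOn G (((n + 2 : ℕ) : ℤ) - 1) A) {P : V → Prop}
    (hP : ∀ a ∈ A, ∀ b ∈ A, G.Adj a b → P a → P b) : ∀ a ∈ A, ∀ b ∈ A, P a → P b := by
  obtain ⟨x, hx, hcon⟩ := h.of_succ.2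
  obtain ⟨z, hz⟩ := (h.of_succ.1 x hx).nonempty
  exact forall_of_adj_of_diff_singleton hx hz (fun _ => hcon.forall_of_adj) hP

/-! ### Proper colourings of spheres -/

/-- `c` restricts to a proper colouring of the subgraph of `G` induced on `A`; the values of `c`
outside `A` are irrelevant. -/
def IsProperOn {α : Type*} (G : SimpleGraph V) (A : Set V) (c : V → α) : Prop :=
  ∀ ⦃x⦄, x ∈ A → ∀ ⦃y⦄, y ∈ A → G.Adj x y → c x ≠ c y

lemma IsProperOn.mono {α : Type*} {B : Set V} {c : V → α} (h : IsProperOn G A c) (hBA : B ⊆ A) :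
    IsProperOn G B c := fun _ hx _ hy => h (hBA hx) (hBA hy)

/-- The vertex set of the ball around `x` in the subgraph of `G` induced on `A`. -/
def ball (G : SimpleGraph V) (A : Set V) (x : V) : Set V :=
  insert x (unitSphere G A x)

lemma mem_ball_self (x : V) : x ∈ ball G A x := Set.mem_insert _ _

lemma mem_ball_of_adj {x y : V} (hy : y ∈ A) (hxy : G.Adj x y) : y ∈ ball G A x := Or.inr ⟨hy, hxy⟩

lemma ball_subset {x : V} (hx : x ∈ A) : ball G A x ⊆ A :=
  Set.insert_subset hx (unitSphere_subset x)

/-- A clique lies in the ball around each of its vertices. -/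
lemma mem_ball_of_isClique {t : Set V} (ht : G.IsClique t) (htA : t ⊆ A) {x z : V} (hx : x ∈ t)
    (hz : z ∈ t) : z ∈ ball G A x := by
  by_cases hzx : z = x
  · exact Or.inl hzx
  · exact mem_ball_of_adj (htA hz) (ht hx hz (Ne.symm hzx))

/-- A clique with at least as many vertices as there are colours shows every colour. -/
lemma IsProperOn.exists_mem_clique {α : Type*} {K : Set α} {c : V → α} {t : Finset V}
    (hc : IsProperOn G t c) (ht : G.IsClique (t : Set V)) (hmaps : ∀ z ∈ t, c z ∈ K)
    (hfin : K.Finite) (hcard : K.ncard ≤ t.card) {k : α} (hk : k ∈ K) : ∃ z ∈ t, c z = k := by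
  have hinj : Set.InjOn c t := fun x hx y hy hxy => by
    by_contra hne
    exact hc hx hy (ht hx hy hne) hxy
  have himage : c '' (t : Set V) = K := by
    refine Set.eq_of_subset_of_ncard_le ?_ ?_ hfin
    · rintro _ ⟨z, hz, rfl⟩
      exact hmaps z hz
    · rw [hinj.ncard_image, Set.ncard_coe_finset]
      exact hcard
  obtain ⟨z, hz, hzk⟩ := himage.symm ▸ hk
  exact ⟨z, hz, hzk⟩

/-- The colour of the centre of a ball is not used on the unit sphere. -/
lemma IsProperOn.ncard_image_unitSphere_le [Finite V] {α : Type*} {c : V → α} {n : ℕ} {x : V}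
    {B : Set V} (hc : IsProperOn G (ball G A x) c) (hB : ball G A x ⊆ B)
    (hn : (c '' B).ncard ≤ n + 1) : (c '' unitSphere G A x).ncard ≤ n := by
  have hx : c x ∈ c '' B := Set.mem_image_of_mem c (hB (mem_ball_self x))
  have hsub : c '' unitSphere G A x ⊆ (c '' B) \ {c x} := by
    rintro _ ⟨y, hy, rfl⟩
    exact ⟨⟨y, hB (Or.inr hy), rfl⟩, (hc (mem_ball_self x) (Or.inr hy) hy.2).symm⟩
  have h1 := Set.ncard_le_ncard hsub (Set.toFinite _)
  rw [Set.ncard_sdiff_singleton_of_mem hx] at h1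
  omega

/-- A proper colouring of a `d`-sphere with `d + 1` colours is unique up to the names of the
colours: two such colourings have the same colour classes. -/
lemma IsSphereOn.color_eq_of_color_eq [Finite V] {α β : Type*} {n : ℕ}
    (h : IsSphereOn G ((n : ℤ) - 1) A) {c : V → α} {c' : V → β} (hc : IsProperOn G A c)
    (hc' : IsProperOn G A c') (hn : (c '' A).ncard ≤ n) (hn' : (c' '' A).ncard ≤ n) {x y : V}
    (hx : x ∈ A) (hy : y ∈ A) (hxy : c x = c y) : c' x = c' y := by
  induction n generalizing A x y with
  | zero => simp [h.eq_empty] at hx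
  | succ n ih =>
    obtain _ | n := n
    -- With a single colour for the whole sphere there is nothing to compare.
    · exact (Set.ncard_le_one_iff (Set.toFinite _)).1 hn' ⟨x, hx, rfl⟩ ⟨y, hy, rfl⟩
    have hlocal : ∀ v ∈ A, ∀ a ∈ ball G A v, ∀ b ∈ ball G A v, c a = c b → c' a = c' b := by
      rintro v hv a ha b hb hab
      have hcv := hc.mono (ball_subset (G := G) hv)
      have hcv' := hc'.mono (ball_subset (G := G) hv)
      rcases ha with rfl | ha <;> rcases hb with rfl | hb
      · rfl
      · exact absurd hab (hc hv hb.1 hb.2)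
      · exact absurd hab.symm (hc hv ha.1 ha.2)
      · exact ih (h.of_succ.1 v hv) (hc.mono (unitSphere_subset v)) (hc'.mono (unitSphere_subset v))
          (hcv.ncard_image_unitSphere_le (ball_subset hv) hn)
          (hcv'.ncard_image_unitSphere_le (ball_subset hv) hn') ha hb hab
    -- The colour that corresponds to `c x` in the ball around `v` does not depend on `v`, because
    -- the balls around two adjacent vertices share a clique that shows all colours.
    have hglobal := h.forall_of_adj (P := fun v => ∀ z ∈ ball G A v, c z = c x → c' z = c' x)
      (fun v hv w hw hvw hPv z hz hzx => by
        classical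
        obtain ⟨t, hst, htA, ht, hcard⟩ := h.exists_clique_superset (s := {v, w})
          (by simp [Set.insert_subset_iff, hv, hw])
          (by simpa [SimpleGraph.isClique_insert] using fun _ => hvw)
        have hvt : v ∈ t := hst (by simp)
        have hwt : w ∈ t := hst (by simp)
        obtain ⟨z', hz't, hz'x⟩ := (hc.mono htA).exists_mem_clique ht
          (fun a ha => Set.mem_image_of_mem c (htA ha)) (Set.toFinite _) (hcard ▸ hn)
          (Set.mem_image_of_mem c hx)
        rw [hlocal w hw z hz z' (mem_ball_of_isClique ht htA hwt hz't) (hzx.trans hz'x.symm)]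
        exact hPv z' (mem_ball_of_isClique ht htA hvt hz't) hz'x)
    exact (hglobal x hx y hy (fun z hz hzx => hlocal x hx z hz x (mem_ball_self x) hzx) y
      (mem_ball_self y) hxy.symm).symm

/-! ### The permutation between the colourings of two balls -/

/-- Every colour of the star of a simplex `s` of a `d`-sphere occurs there, if `d + 1` colours are
available. -/
lemma IsSphereOn.exists_color_eq {n : ℕ} (h : IsSphereOn G ((n : ℤ) - 1) A) {s : Finset V}
    (hsA : (s : Set V) ⊆ A) (hs : G.IsClique (s : Set V)) {x : V} (hx : x ∈ s) {c : V → Fin n}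
    (hc : IsProperOn G (ball G A x) c) (k : Fin n) : ∃ z, (∀ y ∈ s, z ∈ ball G A y) ∧ c z = k := by
  obtain ⟨t, hst, htA, ht, hcard⟩ := h.exists_clique_superset hsA hs
  obtain ⟨z, hzt, hz⟩ := IsProperOn.exists_mem_clique (K := Set.univ)
    (hc.mono fun z hz => mem_ball_of_isClique ht htA (hst hx) hz) ht (fun _ _ => trivial)
    Set.finite_univ (by simp [Set.ncard_univ, hcard]) (Set.mem_univ k)
  exact ⟨z, fun y hy => mem_ball_of_isClique ht htA (hst hy) hzt, hz⟩

/-- Colourings of the balls around two adjacent vertices have the same colour classes on the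
intersection of the balls, which is the join of an edge and a sphere. -/
lemma IsSphereOn.color_eq_of_color_eq_of_adj [Finite V] {n : ℕ} (h : IsSphereOn G ((n : ℤ) - 1) A)
    {v w : V} (hv : v ∈ A) (hw : w ∈ A) (hvw : G.Adj v w) {c c' : V → Fin n}
    (hc : IsProperOn G (ball G A v) c) (hc' : IsProperOn G (ball G A w) c') {x y : V}
    (hxv : x ∈ ball G A v) (hxw : x ∈ ball G A w) (hyv : y ∈ ball G A v) (hyw : y ∈ ball G A w)
    (hxy : c x = c y) : c' x = c' y := by
  obtain _ | _ | n := n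
  · exact (c x).elim0
  · exact Subsingleton.elim (α := Fin 1) _ _
  by_cases hne : x = y
  · rw [hne]
  have hadj : ¬ G.Adj x y := fun hadj => hc hxv hyv hadj hxy
  -- Nonadjacent points of the intersection lie in the unit spheres of both centres.
  have hxv' : G.Adj v x := by
    rcases hxv with rfl | hxv
    · rcases hyv with rfl | hyv
      exacts [absurd rfl hne, absurd hyv.2 hadj]
    · exact hxv.2
  have hyv' : G.Adj v y := by
    rcases hyv with rfl | hyv
    exacts [absurd hxv'.symm hadj, hyv.2]
  have hxw' : G.Adj w x := by
    rcases hxw with rfl | hxw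
    · rcases hyw with rfl | hyw
      exacts [absurd rfl hne, absurd hyw.2 hadj]
    · exact hxw.2
  have hyw' : G.Adj w y := by
    rcases hyw with rfl | hyw
    exacts [absurd hxw'.symm hadj, hyw.2]
  have hxA := ball_subset hv hxv
  have hyA := ball_subset hv hyv
  have hwS : w ∈ unitSphere G A v := ⟨hw, hvw⟩
  have hvS : v ∈ unitSphere G A w := ⟨hv, hvw.symm⟩
  have hD := ((h.of_succ.1 v hv).of_succ).1 w hwS
  have hswap : unitSphere G (unitSphere G A v) w = unitSphere G (unitSphere G A w) v := by
    ext z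
    simp only [mem_unitSphere]
    tauto
  have key : ∀ {f : V → Fin (n + 1 + 1)} {a b : V}, a ∈ A → b ∈ unitSphere G A a →
      IsProperOn G (ball G A a) f →
      IsProperOn G (unitSphere G (unitSphere G A a) b) f ∧
        (f '' unitSphere G (unitSphere G A a) b).ncard ≤ n := fun {f a b} ha hb hf => by
    have huniv : (f '' Set.univ).ncard ≤ n + 1 + 1 := by
      simpa [Set.ncard_univ] using
        Set.ncard_le_ncard (Set.subset_univ (f '' Set.univ)) (Set.toFinite _)
    have hf' : IsProperOn G (unitSphere G A a) f := hf.mono (Set.subset_insert _ _)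
    exact ⟨hf'.mono (unitSphere_subset b),
      (hf'.mono (ball_subset hb)).ncard_image_unitSphere_le (ball_subset hb)
        (hf.ncard_image_unitSphere_le (Set.subset_univ _) huniv)⟩
  obtain ⟨hp, hcard⟩ := key hv hwS hc
  obtain ⟨hp', hcard'⟩ := key hw hvS hc'
  rw [← hswap] at hp' hcard'
  exact hD.color_eq_of_color_eq hp hp' hcard hcard' ⟨⟨hxA, hxv'⟩, hxw'⟩ ⟨⟨hyA, hyv'⟩, hyw'⟩ hxy

/-- A permutation of the colours carries the colouring of one ball to that of an adjacent ball,
where both are defined. -/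
lemma IsSphereOn.exists_perm [Finite V] {n : ℕ} (h : IsSphereOn G ((n : ℤ) - 1) A)
    {v w : V} (hv : v ∈ A) (hw : w ∈ A) (hvw : G.Adj v w) {c c' : V → Fin n}
    (hc : IsProperOn G (ball G A v) c) (hc' : IsProperOn G (ball G A w) c') :
    ∃ φ : Equiv.Perm (Fin n), ∀ z ∈ ball G A v, z ∈ ball G A w → c' z = φ (c z) := by
  classical
  have hex : ∀ k, ∃ z, (∀ y ∈ ({v, w} : Finset V), z ∈ ball G A y) ∧ c z = k :=
    h.exists_color_eq (by simp [Set.insert_subset_iff, hv, hw])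
      (by simpa [SimpleGraph.isClique_insert] using fun _ => hvw) (by simp) hc
  choose z hz hzc using hex
  have hzv : ∀ k, z k ∈ ball G A v := fun k => hz k v (by simp)
  have hzw : ∀ k, z k ∈ ball G A w := fun k => hz k w (by simp)
  have hinj : Function.Injective fun k => c' (z k) := fun k l hkl => by
    rw [← hzc k, ← hzc l]
    exact h.color_eq_of_color_eq_of_adj hw hv hvw.symm hc' hc (hzw k) (hzv k) (hzw l) (hzv l) hkl
  exact ⟨Equiv.ofBijective _ (Finite.injective_iff_bijective.1 hinj), fun a hav haw =>
    h.color_eq_of_color_eq_of_adj hv hw hvw hc hc' hav haw (hzv _) (hzw _) (hzc _).symm⟩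

/-! ### Potentials of cocycles -/

/-- A potential on `A \ {x}` of a cocycle `φ` extends to `A` if the unit sphere of `x` is
connected. -/
lemma exists_potential_insert {Γ : Type*} [Group Γ] {φ : V → V → Γ} {x : V} (hx : x ∈ A)
    (hinv : ∀ a ∈ A, ∀ b ∈ A, G.Adj a b → φ b a * φ a b = 1)
    (htri : ∀ a ∈ A, ∀ b ∈ A, ∀ c ∈ A, G.Adj a b → G.Adj b c → G.Adj a c →
      φ b c * φ a b = φ a c)
    (hconn : ∀ P : V → Prop,
      (∀ a ∈ unitSphere G A x, ∀ b ∈ unitSphere G A x, G.Adj a b → P a → P b) →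
      ∀ a ∈ unitSphere G A x, ∀ b ∈ unitSphere G A x, P a → P b)
    {π : V → Γ} (hπ : ∀ a ∈ A \ {x}, ∀ b ∈ A \ {x}, G.Adj a b → φ a b * π a = π b) :
    ∃ π' : V → Γ, ∀ a ∈ A, ∀ b ∈ A, G.Adj a b → φ a b * π' a = π' b := by
  classical
  obtain ⟨g, hg⟩ : ∃ g, ∀ a ∈ unitSphere G A x, φ a x * π a = g := by
    rcases (unitSphere G A x).eq_empty_or_nonempty with he | ⟨y, hy⟩
    · exact ⟨1, by simp [he]⟩
    · refine ⟨φ y x * π y, fun a ha => hconn (fun a => φ a x * π a = φ y x * π y) ?_ y hy a ha rfl⟩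
      intro a ha b hb hab hPa
      rw [← hPa, ← hπ a ⟨ha.1, ha.2.ne'⟩ b ⟨hb.1, hb.2.ne'⟩ hab, ← mul_assoc,
        htri a ha.1 b hb.1 x hx hab hb.2.symm ha.2.symm]
  refine ⟨Function.update π x g, fun a ha b hb hab => ?_⟩
  by_cases hax : a = x
  · subst hax
    rw [Function.update_self, Function.update_of_ne hab.ne', ← hg b ⟨hb, hab⟩, ← mul_assoc,
      hinv b hb a ha hab.symm, one_mul]
  · by_cases hbx : b = x
    · subst hbx
      rw [Function.update_self, Function.update_of_ne hax, hg a ⟨ha, hab.symm⟩]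
    · rw [Function.update_of_ne hax, Function.update_of_ne hbx, hπ a ⟨ha, hax⟩ b ⟨hb, hbx⟩ hab]

/-- Every cocycle over a contractible graph is a coboundary. -/
lemma IsContractibleOn.exists_potential {Γ : Type*} [Group Γ] {φ : V → V → Γ}
    (h : IsContractibleOn G A)
    (hinv : ∀ a ∈ A, ∀ b ∈ A, G.Adj a b → φ b a * φ a b = 1)
    (htri : ∀ a ∈ A, ∀ b ∈ A, ∀ c ∈ A, G.Adj a b → G.Adj b c → G.Adj a c →
      φ b c * φ a b = φ a c) :
    ∃ π : V → Γ, ∀ a ∈ A, ∀ b ∈ A, G.Adj a b → φ a b * π a = π b := by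
  induction h with
  | point x =>
    refine ⟨1, ?_⟩
    rintro a rfl b rfl hab
    exact absurd rfl hab.ne
  | step A x hx _ hsph ih _ =>
    obtain ⟨π, hπ⟩ := ih (fun a ha b hb => hinv a ha.1 b hb.1)
      (fun a ha b hb c hc => htri a ha.1 b hb.1 c hc.1)
    exact exists_potential_insert hx hinv htri (fun _ => hsph.forall_of_adj) hπ

/-! ### Colourings from potentials -/

/-- Let the balls of a `d`-sphere be properly coloured with `d + 1` colours. Then the permutations
between these colourings form a cocycle, and any potential of it on a set of vertices gives a proper
colouring of that set. -/
lemma IsSphereOn.exists_cocycle [Finite V] {n : ℕ} (h : IsSphereOn G ((n : ℤ) - 1) A)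
    {c : V → V → Fin n} (hc : ∀ v ∈ A, IsProperOn G (ball G A v) (c v)) :
    ∃ φ : V → V → Equiv.Perm (Fin n),
      (∀ u ∈ A, ∀ v ∈ A, G.Adj u v → φ v u * φ u v = 1) ∧
      (∀ u ∈ A, ∀ v ∈ A, ∀ w ∈ A, G.Adj u v → G.Adj v w → G.Adj u w →
        φ v w * φ u v = φ u w) ∧
      ∀ B ⊆ A, ∀ π : V → Equiv.Perm (Fin n),
        (∀ u ∈ B, ∀ v ∈ B, G.Adj u v → φ u v * π u = π v) →
        IsProperOn G B fun v => (π v)⁻¹ (c v v) := by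
  classical
  have hex : ∀ v w, ∃ φ : Equiv.Perm (Fin n), v ∈ A → w ∈ A → G.Adj v w →
      ∀ z ∈ ball G A v, z ∈ ball G A w → c w z = φ (c v z) := fun v w => by
    by_cases hvw : v ∈ A ∧ w ∈ A ∧ G.Adj v w
    · obtain ⟨φ, hφ⟩ := h.exists_perm hvw.1 hvw.2.1 hvw.2.2 (hc v hvw.1) (hc w hvw.2.1)
      exact ⟨φ, fun _ _ _ => hφ⟩
    · exact ⟨1, fun hv hw hadj => absurd ⟨hv, hw, hadj⟩ hvw⟩
  choose φ hφ using hex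
  -- The identities between permutations are checked colour by colour, at a vertex of that colour
  -- that lies in all the balls involved.
  refine ⟨φ, fun u hu v hv huv => ?_, fun u hu v hv w hw huv hvw huw => ?_,
    fun B hBA π hπ u hu v hv huv => ?_⟩
  · ext1 k
    obtain ⟨z, hz, rfl⟩ := h.exists_color_eq (s := {u, v})
      (by simp [Set.insert_subset_iff, hu, hv])
      (by simpa [SimpleGraph.isClique_insert] using fun _ => huv) (x := u) (by simp) (hc u hu) k
    have hzu := hz u (by simp)
    have hzv := hz v (by simp)
    rw [Equiv.Perm.mul_apply, ← hφ u v hu hv huv z hzu hzv, ← hφ v u hv hu huv.symm z hzv hzu,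
      Equiv.Perm.one_apply]
  · ext1 k
    obtain ⟨z, hz, rfl⟩ := h.exists_color_eq (s := {u, v, w})
      (by simp [Set.insert_subset_iff, hu, hv, hw])
      (by
        have h1 := SimpleGraph.is3Clique_triple_iff.2 ⟨huv, huw, hvw⟩
        exact h1.isClique) (x := u) (by simp) (hc u hu) k
    have hzu := hz u (by simp)
    have hzv := hz v (by simp)
    have hzw := hz w (by simp)
    rw [Equiv.Perm.mul_apply, ← hφ u v hu hv huv z hzu hzv, ← hφ v w hv hw hvw z hzv hzw,
      ← hφ u w hu hw huw z hzu hzw]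
  · have huA := hBA hu
    have hvA := hBA hv
    have hv_eq : (π v)⁻¹ (c v v) = (π u)⁻¹ (c u v) := by
      rw [hφ u v huA hvA huv v (mem_ball_of_adj hvA huv) (mem_ball_self v), ← hπ u hu v hv huv,
        mul_inv_rev, Equiv.Perm.mul_apply, ← Equiv.Perm.mul_apply _ (φ u v), inv_mul_cancel,
        Equiv.Perm.one_apply]
    change (π u)⁻¹ (c u u) ≠ (π v)⁻¹ (c v v)
    rw [hv_eq]
    exact fun heq => hc u huA (mem_ball_self u) (mem_ball_of_adj hvA huv) huv
      ((π u)⁻¹.injective heq)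

/-! ### Circles -/

/-- A `0`-sphere consists of two points. -/
lemma IsSphereOn.ncard_eq_two [Finite V] (h : IsSphereOn G (((1 : ℕ) : ℤ) - 1) A) :
    A.ncard = 2 := by
  obtain ⟨hunit, x, hx, hcon⟩ := h.of_succ
  have hsingle : (A \ {x}).ncard = 1 := by
    generalize hB : A \ {x} = B at hcon
    cases hcon with
    | point y => exact Set.ncard_singleton y
    | step _ y hy _ hsph =>
      obtain ⟨z, hz⟩ := hsph.nonempty
      subst hB
      have hzy : z ∈ unitSphere G A y := ⟨hz.1.1, hz.2⟩
      simp [(hunit y hy.1).eq_empty] at hzy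
  rw [← Set.ncard_sdiff_singleton_add_one hx, hsingle]

/-- In a graph with an even number of vertices, all of which have two neighbours, the two neighbours
of `x` have the same colour in every 2-colouring of the complement of `x`. -/
lemma color_eq_of_two_regular [Finite V] {x a b : V} {c : V → Fin 2} (hx : x ∈ A)
    (heven : Even A.ncard) (hdeg : ∀ v ∈ A, (unitSphere G A v).ncard = 2) (hab : a ≠ b)
    (hS : unitSphere G A x = {a, b}) (hc : IsProperOn G (A \ {x}) c) : c a = c b := by
  classical
  have := Fintype.ofFinite V
  by_contra hne
  -- Colours become signs, and `x` gets weight `0`. The sum of `T v w` over all ordered pairs is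
  -- twice the sum of the signs because every vertex has two neighbours. It is also `ε a + ε b`,
  -- because the two ends of an edge that avoids `x` cancel.
  let ε : V → ℤ := fun v => if v = x then 0 else if c v = 0 then 1 else -1
  let T : V → V → ℤ := fun v w => if G.Adj v w then ε v else 0
  have hεx : ε x = 0 := if_pos rfl
  have hε_neg : ∀ v w, v ≠ x → w ≠ x → c v ≠ c w → ε v + ε w = 0 := fun v w hv hw hvw => by
    simp only [ε, if_neg hv, if_neg hw]
    split_ifs <;> first | rfl | omega
  have hsymm : ∀ v ∈ A.toFinset, ∀ w ∈ A.toFinset,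
      T v w + T w v = (if v = x then T w x else 0) + (if w = x then T v x else 0) := by
    intro v hv w hw
    rw [Set.mem_toFinset] at hv hw
    by_cases hvx : v = x
    · subst hvx
      by_cases hwv : w = v
      · subst hwv
        simp [T]
      · simp [T, hεx, hwv]
    · by_cases hwx : w = x
      · subst hwx
        simp [T, hεx, hvx]
      · by_cases hvw : G.Adj v w
        · simp [T, hvx, hwx, hvw, hvw.symm, hε_neg v w hvx hwx (hc ⟨hv, hvx⟩ ⟨hw, hwx⟩ hvw)]
        · have hwv : ¬ G.Adj w v := fun h => hvw h.symm
          simp [T, hvx, hwx, hvw, hwv]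
  have hleft : ∑ v ∈ A.toFinset, ∑ w ∈ A.toFinset, T v w = 2 * ∑ v ∈ A.toFinset, ε v := by
    rw [Finset.mul_sum]
    refine Finset.sum_congr rfl fun v hv => ?_
    have hfilter : unitSphere G A v = ((A.toFinset.filter (G.Adj v) : Finset V) : Set V) := by
      ext
      simp [mem_unitSphere]
    have hcard := hdeg v (Set.mem_toFinset.1 hv)
    rw [hfilter, Set.ncard_coe_finset] at hcard
    simp only [T]
    rw [← Finset.sum_filter, Finset.sum_const, hcard]
    simp
  have hright : ∑ w ∈ A.toFinset, T w x = ε a + ε b := by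
    have hfilter : A.toFinset.filter (fun w => G.Adj w x) = {a, b} := by
      ext z
      have := Set.ext_iff.1 hS z
      simpa [mem_unitSphere, G.adj_comm z x] using this
    simp only [T]
    rw [← Finset.sum_filter, hfilter, Finset.sum_pair hab]
  have hax : a ≠ x :=
    (hS ▸ (by simp : a ∈ ({a, b} : Set V)) : a ∈ unitSphere G A x).2.ne'
  have hbx : b ≠ x :=
    (hS ▸ (by simp : b ∈ ({a, b} : Set V)) : b ∈ unitSphere G A x).2.ne'
  have hdouble := Finset.sum_congr rfl fun v hv => Finset.sum_congr rfl (hsymm v hv)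
  simp only [Finset.sum_add_distrib] at hdouble
  rw [Finset.sum_comm (f := fun v w => T w v), hleft,
    Finset.sum_comm (f := fun v w => if v = x then T w x else 0)] at hdouble
  simp only [Finset.sum_ite_eq', Set.mem_toFinset, hx, if_true, hright,
    hε_neg a b hax hbx hne] at hdouble
  have hzero : ∑ v ∈ A.toFinset, ε v = 0 := by omega
  -- An odd number of signs cannot have sum `0`.
  have hmod := congrArg (Int.cast : ℤ → ZMod 2) hzero
  have hcast : ∀ v, ((ε v : ℤ) : ZMod 2) = 1 - if v = x then 1 else 0 := fun v => by
    simp only [ε]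
    split_ifs <;> simp
  rw [Int.cast_sum, Finset.sum_congr rfl fun v _ => hcast v, Finset.sum_sub_distrib] at hmod
  rw [Set.ncard_eq_toFinset_card', even_iff_two_dvd, ← CharP.cast_eq_zero_iff (ZMod 2) 2] at heven
  simp [hx, -Set.toFinset_card, heven] at hmod

/-- A 2-colouring of the complement of a vertex of a circle of even length extends to the circle. -/
lemma exists_proper_coloring_of_circle [Finite V] {x : V} {c : V → Fin 2} (hx : x ∈ A)
    (heven : Even A.ncard) (h : IsSphereOn G (((2 : ℕ) : ℤ) - 1) A)
    (hc : IsProperOn G (A \ {x}) c) : ∃ c' : V → Fin 2, IsProperOn G A c' := by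
  classical
  have hdeg : ∀ v ∈ A, (unitSphere G A v).ncard = 2 := fun v hv => (h.of_succ.1 v hv).ncard_eq_two
  obtain ⟨a, b, hab, hS⟩ := Set.ncard_eq_two.1 (hdeg x hx)
  have hcab := color_eq_of_two_regular hx heven hdeg hab hS hc
  obtain ⟨k, hk⟩ := exists_ne (c a)
  have hkS : ∀ y ∈ A, G.Adj x y → c y ≠ k := fun y hy hxy => by
    have hyS : y ∈ ({a, b} : Set V) := hS ▸ (⟨hy, hxy⟩ : y ∈ unitSphere G A x)
    rcases hyS with rfl | rfl
    exacts [hk.symm, hcab ▸ hk.symm]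
  refine ⟨Function.update c x k, fun u hu v hv huv => ?_⟩
  by_cases hux : u = x
  · subst hux
    rw [Function.update_self, Function.update_of_ne huv.ne']
    exact (hkS v hv huv).symm
  · by_cases hvx : v = x
    · subst hvx
      rw [Function.update_self, Function.update_of_ne hux]
      exact hkS u hu huv.symm
    · rw [Function.update_of_ne hux, Function.update_of_ne hvx]
      exact hc ⟨hu, hux⟩ ⟨hv, hvx⟩ huv

/-! ### Eulerian spheres -/

/-- An Eulerian `d`-sphere has a proper colouring with `n = d + 1` colours. The condition on the
simplices `s` with `n - 2` vertices is stated as `s.card + 2 = n`, which excludes truncation. The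
empty sphere is listed separately because there are no functions `V → Fin 0` if `V` is nonempty. -/
lemma IsSphereOn.exists_isProperOn [Finite V] {n : ℕ} (h : IsSphereOn G ((n : ℤ) - 1) A)
    (heven : ∀ s : Finset V, (s : Set V) ⊆ A → G.IsClique (s : Set V) → s.card + 2 = n →
      Even {y | y ∈ A ∧ ∀ x ∈ s, G.Adj x y}.ncard) :
    A = ∅ ∨ ∃ c : V → Fin n, IsProperOn G A c := by
  classical
  induction n generalizing A with
  | zero => exact Or.inl h.eq_empty
  | succ n ih =>
    right
    obtain ⟨hunit, x, hx, hcon⟩ := h.of_succ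
    -- The colouring of a unit sphere extends to the ball by a new colour for the centre.
    have hball : ∀ v, ∃ c : V → Fin (n + 1), v ∈ A → IsProperOn G (ball G A v) c := fun v => by
      by_cases hv : v ∈ A
      swap
      · exact ⟨fun _ => 0, fun hv' => absurd hv' hv⟩
      have hself : ∀ {y}, y ∈ unitSphere G A v → y ≠ v := fun hy => hy.2.ne'
      -- The dual sphere of `s` in the unit sphere of `v` is the dual sphere of `s ∪ {v}`.
      have heven_unit : ∀ s : Finset V, (s : Set V) ⊆ unitSphere G A v → G.IsClique (s : Set V) →
          s.card + 2 = n → Even {y | y ∈ unitSphere G A v ∧ ∀ x ∈ s, G.Adj x y}.ncard := by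
        intro s hsA hs hcard
        have hvs : v ∉ s := fun hvs => hself (hsA hvs) rfl
        have hinsert := heven (insert v s)
          (by
            rw [Finset.coe_insert]
            exact Set.insert_subset hv (hsA.trans (unitSphere_subset v)))
          (by
            rw [Finset.coe_insert, SimpleGraph.isClique_insert]
            exact ⟨hs, fun y hy _ => (hsA hy).2⟩)
          (by rw [Finset.card_insert_of_notMem hvs]; omega)
        convert hinsert using 3
        ext y
        simp only [mem_unitSphere, Finset.forall_mem_insert]
        tauto
      rcases ih (hunit v hv) heven_unit with he | ⟨c, hc⟩
      · refine ⟨fun _ => 0, fun _ a ha b hb hab => ?_⟩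
        rw [ball, he] at ha hb
        obtain rfl : a = v := by simpa using ha
        obtain rfl : b = a := by simpa using hb
        exact absurd rfl hab.ne
      · refine ⟨Function.update (fun y => (c y).castSucc) v (Fin.last n), fun _ a ha b hb hab => ?_⟩
        rcases ha with rfl | ha <;> rcases hb with rfl | hb
        · exact absurd rfl hab.ne
        · rw [Function.update_self, Function.update_of_ne (hself hb)]
          exact (Fin.castSucc_lt_last _).ne'
        · rw [Function.update_self, Function.update_of_ne (hself ha)]
          exact (Fin.castSucc_lt_last _).ne
        · rw [Function.update_of_ne (hself ha), Function.update_of_ne (hself hb)]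
          exact fun heq => hc ha hb hab (Fin.castSucc_injective n heq)
    choose c hc using hball
    obtain ⟨φ, hinv, htri, hcolor⟩ := h.exists_cocycle hc
    obtain ⟨π, hπ⟩ := hcon.exists_potential (φ := φ) (fun a ha b hb => hinv a ha.1 b hb.1)
      (fun a ha b hb c hc => htri a ha.1 b hb.1 c hc.1)
    obtain _ | _ | n := n
    · refine ⟨fun _ => 0, fun a ha b hb hab => ?_⟩
      have : b ∈ unitSphere G A a := ⟨hb, hab⟩
      simp [(hunit a ha).eq_empty] at this
    · refine exists_proper_coloring_of_circle hx ?_ h (hcolor _ Set.sdiff_subset π hπ)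
      simpa using heven ∅ (by simp) (by simp) (by simp)
    · obtain ⟨π', hπ'⟩ := exists_potential_insert hx hinv htri
        (fun _ => (hunit x hx).forall_of_adj) hπ
      exact ⟨_, hcolor A subset_rfl π' hπ'⟩

end EulerianSphere

theorem mainTheorem3 {V : Type*} [Finite V] (G : SimpleGraph V) (d : ℤ)
    (hG : EulerianSphere.IsEulerianSphere G d) :
    ∃ n : ℕ, (n : ℤ) = d + 1 ∧ G.chromaticNumber = (n : ℕ∞) := by
  obtain ⟨hsphere, heven⟩ := hG
  obtain ⟨n, hn⟩ : ∃ n : ℕ, (n : ℤ) = d + 1 :=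
    Int.eq_ofNat_of_zero_le (by have := hsphere.neg_one_le; omega) |>.imp fun _ h => h.symm
  obtain rfl : d = (n : ℤ) - 1 := by omega
  refine ⟨n, hn, le_antisymm ?_ ?_⟩
  · rw [SimpleGraph.chromaticNumber_le_iff_colorable]
    have heven' : ∀ s : Finset V, (s : Set V) ⊆ Set.univ → G.IsClique (s : Set V) →
        s.card + 2 = n → Even {y | y ∈ Set.univ ∧ ∀ x ∈ s, G.Adj x y}.ncard := by
      intro s _ hs hcard
      convert heven s ⟨hs, by omega⟩ using 1
      unfold EulerianSphere.degree
      congr 1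
      ext y
      simp [EulerianSphere.dualSphere, EulerianSphere.mem_unitSphere]
    rcases hsphere.exists_isProperOn heven' with he | ⟨c, hc⟩
    · have : IsEmpty V := Set.univ_eq_empty_iff.1 he
      exact SimpleGraph.Colorable.of_isEmpty n
    · exact ⟨SimpleGraph.Coloring.mk c fun hab => hc trivial trivial hab⟩
  · obtain ⟨t, -, -, ht, hcard⟩ := hsphere.exists_clique_superset (s := ∅) (by simp) (by simp)
    rw [← hcard]
    exact ht.card_le_chromaticNumber
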